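/- Let $\mathbf a=(a_1,a_2,a_3)\in\mathbb R^3$, $b\neq 0$, and consider the plant $\dot x_1=x_2,\ \dot x_2=x_3,\ \dot x_3=a_1x_1+a_2x_2+a_3x_3+d(t)+bu$ with output $y=x_1$, under the ADRC law $u=-\frac1{\hat b}(K\hat x+\hat d)$ with $\hat b\neq0$, $K=(k_1,k_2,k_3)\in\mathbb R^{3}$, and the extended state observer $\dot{\hat x}_1=\hat x_2-g_1(\hat x_1-y)$, $\dot{\hat x}_2=\hat x_3-g_2(\hat x_1-y)$, $\dot{\hat x}_3=\hat d+\hat b u-g_3(\hat x_1-y)$, $\dot{\hat d}=-g_4(\hat x_1-y)$, $G=(g_1,\dots,g_4)\in\mathbb R^4$. Let $d(t)=d_{ss}+\gamma(t)$ with $d_{ss}\in\mathbb R$ constant and $\gamma$ generated by $$\dot\chi=f_d(\chi),\qquad \gamma=C_d\chi, \tag{1}$$ where $\chi\in\mathbb R^M$, $f_d:\mathbb R^M\to\mathbb R^M$ is locally Lipschitz and $C_d\in\mathbb R^{1\times M}$. With $\tilde x=\hat x-x$, $\tilde d=\frac b{\hat b}\hat d-d_{ss}$, $\xi=(x,\tilde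 x,\tilde d)\in\mathbb R^7$ and $r=b/\hat b$, the closed loop is $$\dot\xi=A_{CL}\,\xi+B_{CL}C_d\,\chi,\qquad B_{CL}=[0,0,1,0,0,-1,0]^T, \tag{2}$$ $$A_{CL}=\begin{bmatrix} 0&1&0&0&0&0&0\\ 0&0&1&0&0&0&0\\ a_1-rk_1&a_2-rk_2&a_3-rk_3&-rk_1&-rk_2&-rk_3&-1\\ 0&0&0&-g_1&1&0&0\\ 0&0&0&-g_2&0&1&0\\ (r-1)k_1-a_1&(r-1)k_2-a_2&(r-1)k_3-a_3&(r-1)k_1-g_3&(r-1)k_2&(r-1)k_3&1\\ 0&0&0&-rg_4&0&0&0 \end{bmatrix}.$$ A system $\dot z=f(z)$ is called globally asymptotically stable to the origin if $f(0)=0$; from every initial state there is a solution on $[0,\infty)$; for every $\varepsilon>0$ there is $\delta>0$ such that every solution on $[0,\infty)$ with $\|z(0)\|<\delta$ satisfies $\|z(t)\|<\varepsilon$ for all $t\ge0$; and every solution on $[0,\infty)$ satisfies $z(t)\to0$ as $t\to\infty$. **Corollary (Stable Time-Varying Disturbance).** If $A_{CL}$ is Hurwitz (all its complex eigenvalues have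 negative real part) and the system (1) is globally asymptotically stable to the origin, then the cascade of (1) and (2), with state $(\xi,\chi)\in\mathbb R^{7+M}$, is globally asymptotically stable to the origin. -/

import Mathlib

open Filter Topology

noncomputable section

namespace ADRC

/-! ### Global asymptotic stability of an autonomous system `z' = f z` -/

/-- `z` solves `z' = f z` on `[0, ∞)` (two-sided derivative for `t > 0`, right derivative at `0`).
The values of `z` at negative times are irrelevant. -/
def IsForwardSolution {E : Type*} [NormedAddCommGroup E] [NormedSpace ℝ E]
    (f : E → E) (z : ℝ → E) : Prop :=
  ∀ t, 0 ≤ t → HasDerivWithinAt z (f (z t)) (Set.Ici 0) t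

/-- The system `z' = f z` is globally asymptotically stable to the origin: the origin is an
equilibrium, from each initial state there is a solution for all forward time, the origin is
stable in the sense of Lyapunov, and every solution converges to the origin. -/
structure IsGAS {E : Type*} [NormedAddCommGroup E] [NormedSpace ℝ E] (f : E → E) : Prop where
  equilibrium : f 0 = 0
  forward_complete : ∀ z₀ : E, ∃ z : ℝ → E, IsForwardSolution f z ∧ z 0 = z₀
  stable : ∀ ε : ℝ, 0 < ε → ∃ δ : ℝ, 0 < δ ∧ ∀ z : ℝ → E, IsForwardSolution f z →
    ‖z 0‖ < δ → ∀ t, 0 ≤ t → ‖z t‖ < ε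
  attractive : ∀ z : ℝ → E, IsForwardSolution f z → Tendsto z atTop (𝓝 0)

/-- A real square matrix is Hurwitz if all its complex eigenvalues have negative real part. -/
def IsHurwitz {n : Type*} [Fintype n] [DecidableEq n] (A : Matrix n n ℝ) : Prop :=
  ∀ μ ∈ spectrum ℂ (A.map (algebraMap ℝ ℂ)), μ.re < 0

/-! ### Plant, controller and observer -/

/-- Right-hand side of the plant in canonical form, with disturbance `d` and input `u`. -/
def plantField (a : Fin 3 → ℝ) (b : ℝ) (x : Fin 3 → ℝ) (d u : ℝ) : Fin 3 → ℝ :=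
  !![0, 1, 0; 0, 0, 1; a 0, a 1, a 2].mulVec x + d • ![0, 0, 1] + u • ![0, 0, b]

/-- The ADRC control law `u = -(1 / b̂) (K x̂ + d̂)`. -/
def control (bhat : ℝ) (K : Fin 3 → ℝ) (xhat : Fin 3 → ℝ) (dhat : ℝ) : ℝ :=
  -(1 / bhat) * (K ⬝ᵥ xhat + dhat)

/-- Right-hand side of the linear extended state observer for `(x̂, d̂)`, with input `u` and
measured output `y`. -/
def observerField (bhat : ℝ) (G : Fin 4 → ℝ) (xhat : Fin 3 → ℝ) (dhat u y : ℝ) : Fin 4 → ℝ :=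
  !![0, 1, 0, 0; 0, 0, 1, 0; 0, 0, 0, 1; 0, 0, 0, 0].mulVec
      ![xhat 0, xhat 1, xhat 2, dhat]
    + u • ![0, 0, bhat, 0] - (xhat 0 - y) • G

/-! ### Closed loop in the coordinates `(x, x̃, d̃)`,
`x̃ = x̂ - x`, `d̃ = (b / b̂) d̂ - d_ss` -/

/-- The closed-loop matrix `A_CL`, for arbitrary `b` and `b̂`. -/
def closedLoopMatrix (a : Fin 3 → ℝ) (b bhat : ℝ) (K : Fin 3 → ℝ) (G : Fin 4 → ℝ) :
    Matrix (Fin 7) (Fin 7) ℝ :=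
  let r := b / bhat
  !![0, 1, 0, 0, 0, 0, 0;
     0, 0, 1, 0, 0, 0, 0;
     a 0 - r * K 0, a 1 - r * K 1, a 2 - r * K 2, -(r * K 0), -(r * K 1), -(r * K 2), -1;
     0, 0, 0, -G 0, 1, 0, 0;
     0, 0, 0, -G 1, 0, 1, 0;
     (r - 1) * K 0 - a 0, (r - 1) * K 1 - a 1, (r - 1) * K 2 - a 2,
       (r - 1) * K 0 - G 2, (r - 1) * K 1, (r - 1) * K 2, 1;
     0, 0, 0, -(r * G 3), 0, 0, 0]

/-- `B_CL`, the column through which the time-varying part of the disturbance enters. -/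
def closedLoopInput : Matrix (Fin 7) (Fin 1) ℝ :=
  !![0; 0; 1; 0; 0; -1; 0]

/-- The matrices `A_CL` and `B_CL` are those of the loop formed by plant, control law and
observer: with disturbance `d = d_ss + γ`, the derivative of `(x, x̃, d̃)` dictated by the plant
and the observer is `A_CL (x, x̃, d̃) + B_CL γ`. -/
theorem closedLoop_eq (a : Fin 3 → ℝ) (b bhat : ℝ) (hbhat : bhat ≠ 0)
    (K : Fin 3 → ℝ) (G : Fin 4 → ℝ) (x xhat : Fin 3 → ℝ) (dhat dss γ : ℝ) :
    let u := control bhat K xhat dhat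
    let dx := plantField a b x (dss + γ) u
    let dobs := observerField bhat G xhat dhat u (x 0)
    ![dx 0, dx 1, dx 2, dobs 0 - dx 0, dobs 1 - dx 1, dobs 2 - dx 2, b / bhat * dobs 3]
      = (closedLoopMatrix a b bhat K G).mulVec
          ![x 0, x 1, x 2, xhat 0 - x 0, xhat 1 - x 1, xhat 2 - x 2, b / bhat * dhat - dss]
        + closedLoopInput.mulVec ![γ] := by
  intro u dx dobs
  ext i
  fin_cases i <;>
    simp [u, dx, dobs, control, plantField, observerField, closedLoopMatrix, closedLoopInput,
      dotProduct, Fin.sum_univ_succ, Matrix.vecHead, Matrix.vecTail] <;>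
    field_simp <;> ring

/-- Right-hand side of the cascade of the disturbance generator `χ' = f_d χ`, `γ = C_d χ`, and the
closed loop `ξ' = A_CL ξ + B_CL C_d χ`, where `ξ = (x, x̃, d̃)`. The state is `(ξ, χ)`. The norm
on the product is the maximum of the two Euclidean norms; it is equivalent to the Euclidean norm
on `ℝ^(7+M)`, so global asymptotic stability means the same for both. -/
def cascadeField (a : Fin 3 → ℝ) (b bhat : ℝ) (K : Fin 3 → ℝ) (G : Fin 4 → ℝ) {M : ℕ}
    (fd : EuclideanSpace ℝ (Fin M) → EuclideanSpace ℝ (Fin M)) (Cd : Matrix (Fin 1) (Fin M) ℝ)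
    (z : EuclideanSpace ℝ (Fin 7) × EuclideanSpace ℝ (Fin M)) :
    EuclideanSpace ℝ (Fin 7) × EuclideanSpace ℝ (Fin M) :=
  (Matrix.toEuclideanLin (closedLoopMatrix a b bhat K G) z.1
      + Matrix.toEuclideanLin (closedLoopInput * Cd) z.2,
    fd z.2)

end ADRC

end

/-! The spectrum of `exp A` consists of the `exp μ` with `μ` in the spectrum of `A`. For a Hurwitz
matrix these lie in the open unit disc, so the spectral radius formula gives `exp A ^ k → 0`. A
semigroup with one contracting member decays exponentially: `‖exp (t • A)‖ ≤ c * exp (-λ * t)`.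
Variation of constants then bounds every solution of `ξ' = A ξ + u` by
`‖ξ t‖ ≤ c * exp (-λ * (t - s)) * ‖ξ s‖ + (c / λ) * sup_{[s, t]} ‖u‖`.
In the cascade the input is a continuous function of `χ` that vanishes at the origin. With `s = 0`
the bound transfers Lyapunov stability from `χ` to `ξ`; with `s` so large that the input stays small
after `s`, it transfers convergence to the origin. -/

open NormedSpace

namespace ADRC

theorem spectrum_centralizer_coe {R A : Type*} [CommRing R] [Ring A] [Algebra R A] {s : Set A}
    (x : Subalgebra.centralizer R s) : spectrum R (x : A) = spectrum R x := by
  refine (spectrum.subset_subalgebra x).antisymm fun r hr hu ↦ hr ?_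
  obtain ⟨u, hu⟩ : IsUnit (algebraMap R A r - x) := hu
  have hmem : (↑u⁻¹ : A) ∈ Subalgebra.centralizer R s := fun y hy ↦
    Commute.units_inv_right (hu ▸ (algebraMap R _ r - x).2 y hy : Commute y u)
  refine isUnit_iff_exists.2 ⟨⟨_, hmem⟩, Subtype.ext ?_, Subtype.ext ?_⟩
  · exact (congrArg (· * (↑u⁻¹ : A)) hu).symm.trans u.mul_inv
  · exact (congrArg ((↑u⁻¹ : A) * ·) hu).symm.trans u.inv_mul

theorem spectrum_exp_of_comm {A : Type*} [NormedCommRing A] [NormedAlgebra ℂ A] [CompleteSpace A]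
    (a : A) : spectrum ℂ (exp a) = Complex.exp '' spectrum ℂ a := by
  let _ : NormedAlgebra ℚ A := .restrictScalars ℚ ℂ A
  have hexp (f : WeakDual.characterSpace ℂ A) : f (exp a) = Complex.exp (f a) := by
    rw [Complex.exp_eq_exp_ℂ, map_exp f (map_continuous f)]
  ext z
  simp only [Set.mem_image, WeakDual.CharacterSpace.mem_spectrum_iff_exists, hexp,
    exists_exists_eq_and]

-- Inside its bicommutant, a commutative closed subalgebra in which spectra do not change, `a` is
-- accessible to characters.
theorem spectrum_exp {A : Type*} [NormedRing A] [NormedAlgebra ℂ A] [CompleteSpace A] (a : A) :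
    spectrum ℂ (exp a) = Complex.exp '' spectrum ℂ a := by
  let _ : NormedAlgebra ℚ A := .restrictScalars ℚ ℂ A
  let S := Subalgebra.centralizer ℂ (Set.centralizer {a})
  let _ : NormedAlgebra ℚ S := .restrictScalars ℚ ℂ S
  have hS : IsClosed (S : Set A) := Set.isClosed_centralizer _
  have : CompleteSpace S := hS.completeSpace_coe
  let _ : NormedCommRing S :=
    { (inferInstance : NormedRing S) with
      mul_comm := fun x y ↦ Subtype.ext <|
        Set.centralizer_centralizer_comm_of_comm (S := {a}) (by simp) (x : A) x.2 y y.2 }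
  let a' : S := ⟨a, Set.subset_centralizer_centralizer rfl⟩
  have hexp : exp a = (exp a' : S) := (map_exp S.val continuous_subtype_val a').symm
  rw [hexp, spectrum_centralizer_coe, spectrum_exp_of_comm, ← spectrum_centralizer_coe]

theorem tendsto_pow_atTop_nhds_zero_of_spectralRadius_lt_one {A : Type*} [NormedRing A]
    [NormedAlgebra ℂ A] [CompleteSpace A] {a : A} (ha : spectralRadius ℂ a < 1) :
    Tendsto (fun n : ℕ ↦ a ^ n) atTop (𝓝 0) := by
  obtain ⟨q, hq, hq1⟩ := ENNReal.lt_iff_exists_nnreal_btwn.1 ha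
  have hroot :=
    (spectrum.pow_nnnorm_pow_one_div_tendsto_nhds_spectralRadius a).eventually_lt_const hq
  refine squeeze_zero_norm' ?_ (tendsto_pow_atTop_nhds_zero_of_lt_one q.2 (by exact_mod_cast hq1))
  filter_upwards [hroot, eventually_ne_atTop 0] with n hn hn0
  rw [one_div, ENNReal.rpow_inv_lt_iff (by positivity), ENNReal.rpow_natCast] at hn
  exact_mod_cast hn.le

theorem tendsto_exp_pow_of_forall_mem_spectrum_re_neg {A : Type*} [NormedRing A]
    [NormedAlgebra ℂ A] [CompleteSpace A] {a : A} (ha : ∀ μ ∈ spectrum ℂ a, μ.re < 0) :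
    Tendsto (fun n : ℕ ↦ exp a ^ n) atTop (𝓝 0) := by
  rcases subsingleton_or_nontrivial A with _ | _
  · simp [Subsingleton.elim (_ : A) 0]
  refine tendsto_pow_atTop_nhds_zero_of_spectralRadius_lt_one ?_
  refine spectrum.spectralRadius_lt_of_forall_lt (r := 1) _ fun z hz ↦ ?_
  obtain ⟨μ, hμ, rfl⟩ := spectrum_exp a ▸ hz
  change ‖Complex.exp μ‖ < 1
  rw [Complex.norm_exp, Real.exp_lt_one_iff]
  exact ha μ hμ

/-- The semigroup `t ↦ exp (t • a)` decays exponentially, i.e. the system `z' = a z` is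
exponentially stable. -/
def IsExponentiallyStable {𝔸 : Type*} [NormedRing 𝔸] [NormedAlgebra ℝ 𝔸] (a : 𝔸) : Prop :=
  ∃ c lam : ℝ, 0 < c ∧ 0 < lam ∧ ∀ t, 0 ≤ t → ‖exp (t • a)‖ ≤ c * Real.exp (-(lam * t))

theorem exists_le_mul_exp_neg_of_add_le_mul {φ : ℝ → ℝ} {p q : ℝ} (hp : 0 < p)
    (hq : 0 < q) (hq1 : q < 1) (hbdd : BddAbove (φ '' Set.Icc 0 p))
    (hstep : ∀ t, 0 ≤ t → φ (t + p) ≤ q * φ t) :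
    ∃ c lam : ℝ, 0 < c ∧ 0 < lam ∧ ∀ t, 0 ≤ t → φ t ≤ c * Real.exp (-(lam * t)) := by
  obtain ⟨C, hC⟩ := hbdd
  have hiter (s : ℝ) (hs : 0 ≤ s) (m : ℕ) : φ (s + m * p) ≤ q ^ m * φ s := by
    induction m with
    | zero => simp
    | succ m ih =>
      calc φ (s + (m + 1 : ℕ) * p) = φ (s + m * p + p) := by push_cast; ring_nf
        _ ≤ q * (q ^ m * φ s) := (hstep _ (by positivity)).trans (by gcongr)
        _ = q ^ (m + 1) * φ s := by ring
  set lam := -Real.log q / p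
  have hlam : 0 < lam := div_pos (neg_pos.2 (Real.log_neg hq hq1)) hp
  have hqlam : q = Real.exp (-(lam * p)) := by
    rw [div_mul_cancel₀ _ hp.ne', neg_neg, Real.exp_log hq]
  refine ⟨max C 1 * Real.exp (lam * p), lam, by positivity, hlam, fun t ht ↦ ?_⟩
  set m := ⌊t / p⌋₊
  have hm : m * p ≤ t := (le_div_iff₀ hp).1 (Nat.floor_le (by positivity))
  have hm' : t < (m + 1) * p := (div_lt_iff₀ hp).1 (Nat.lt_floor_add_one _)
  calc φ t = φ (t - m * p + m * p) := by rw [sub_add_cancel]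
    _ ≤ q ^ m * φ (t - m * p) := hiter _ (sub_nonneg.2 hm) m
    _ ≤ q ^ m * max C 1 := by
      gcongr
      exact (hC ⟨_, ⟨by linarith, by linarith⟩, rfl⟩).trans (le_max_left _ _)
    _ = max C 1 * Real.exp (-(lam * (m * p))) := by
      rw [hqlam, ← Real.exp_nat_mul, mul_comm]; ring_nf
    _ ≤ max C 1 * Real.exp (lam * p - lam * t) := by
      gcongr
      nlinarith
    _ = max C 1 * Real.exp (lam * p) * Real.exp (-(lam * t)) := by
      rw [mul_assoc, ← Real.exp_add, sub_eq_add_neg]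

section BanachAlgebra

variable {𝔸 : Type*} [NormedRing 𝔸] [NormedAlgebra ℝ 𝔸] [CompleteSpace 𝔸]

theorem exp_add_smul (s t : ℝ) (a : 𝔸) : exp ((s + t) • a) = exp (s • a) * exp (t • a) := by
  let _ : NormedAlgebra ℚ 𝔸 := .restrictScalars ℚ ℝ 𝔸
  rw [add_smul, exp_add_of_commute (((Commute.refl a).smul_left s).smul_right t)]

theorem isExponentiallyStable_of_tendsto_exp_pow {a : 𝔸}
    (ha : Tendsto (fun n : ℕ ↦ exp a ^ n) atTop (𝓝 0)) : IsExponentiallyStable a := by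
  let _ : NormedAlgebra ℚ 𝔸 := .restrictScalars ℚ ℝ 𝔸
  obtain ⟨p, hp, hp0⟩ :=
    ((ha.norm.eventually_lt_const (norm_zero.trans_lt one_half_pos)).and
      (eventually_gt_atTop 0)).exists
  have hcont : Continuous fun t : ℝ ↦ ‖exp (t • a)‖ :=
    (differentiable_exp_smul_const ℝ a).continuous.norm
  refine exists_le_mul_exp_neg_of_add_le_mul (Nat.cast_pos.2 hp0) one_half_pos one_half_lt_one
    (isCompact_Icc.bddAbove_image hcont.continuousOn) fun t _ ↦ ?_
  rw [add_comm, exp_add_smul, Nat.cast_smul_eq_nsmul, exp_nsmul]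
  exact (norm_mul_le _ _).trans (by gcongr)

end BanachAlgebra

section Hurwitz

variable {n : Type*} [Fintype n] [DecidableEq n]

open scoped Matrix.Norms.L2Operator in
theorem exp_map_algebraMap (𝕜 : Type*) [RCLike 𝕜] (A : Matrix n n ℝ) :
    exp (A.map (algebraMap ℝ 𝕜)) = (exp A).map (algebraMap ℝ 𝕜) := by
  let _ : NormedAlgebra ℚ (Matrix n n ℝ) := .restrictScalars ℚ ℝ _
  let _ : NormedAlgebra ℚ (Matrix n n 𝕜) := .restrictScalars ℚ 𝕜 _
  exact (map_exp (algebraMap ℝ 𝕜).mapMatrix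
    (continuous_id.matrix_map (algebraMapCLM ℝ 𝕜).continuous) A).symm

open scoped Matrix.Norms.L2Operator in
theorem IsHurwitz.tendsto_exp_pow {A : Matrix n n ℝ} (hA : IsHurwitz A) :
    Tendsto (fun k : ℕ ↦ exp A ^ k) atTop (𝓝 0) := by
  have hcomplex : Tendsto (fun k : ℕ ↦ (exp A ^ k).map (algebraMap ℝ ℂ)) atTop (𝓝 0) := by
    refine (tendsto_exp_pow_of_forall_mem_spectrum_re_neg hA).congr fun k ↦ ?_
    rw [exp_map_algebraMap]
    exact (map_pow (algebraMap ℝ ℂ).mapMatrix _ k).symm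
  have hre :=
    ((continuous_id.matrix_map Complex.continuous_re).tendsto' 0 0 (by simp)).comp hcomplex
  exact hre.congr fun k ↦ by ext; simp

open scoped Matrix.Norms.L2Operator in
theorem IsHurwitz.isExponentiallyStable {A : Matrix n n ℝ} (hA : IsHurwitz A) :
    IsExponentiallyStable (Matrix.toEuclideanCLM (𝕜 := ℝ) A) := by
  let Φ := Matrix.toEuclideanCLM (𝕜 := ℝ) (n := n)
  let _ : NormedAlgebra ℚ (Matrix n n ℝ) := .restrictScalars ℚ ℝ _
  have hΦ : Continuous Φ :=
    LinearMap.continuous_of_finiteDimensional Φ.toAlgEquiv.toLinearMap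
  refine isExponentiallyStable_of_tendsto_exp_pow ?_
  refine ((hΦ.tendsto' 0 0 (map_zero Φ)).comp hA.tendsto_exp_pow).congr fun k ↦ ?_
  rw [Function.comp_apply, map_pow, map_exp Φ hΦ]

end Hurwitz

section LinearSystem

variable {E : Type*} [NormedAddCommGroup E] [NormedSpace ℝ E]

/-- `ξ` solves the linear system `ξ' = T ξ + u` with input `u` on `[0, ∞)`, in the same sense as
`IsForwardSolution`. -/
def IsForcedSolution (T : E →L[ℝ] E) (u ξ : ℝ → E) : Prop :=
  ∀ t, 0 ≤ t → HasDerivWithinAt ξ (T (ξ t) + u t) (Set.Ici 0) t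

variable [CompleteSpace E] {T : E →L[ℝ] E} {u ξ : ℝ → E}

theorem exists_isForcedSolution (T : E →L[ℝ] E) (hu : ContinuousOn u (Set.Ici 0)) (ξ₀ : E) :
    ∃ ξ, IsForcedSolution T u ξ ∧ ξ 0 = ξ₀ := by
  have hcont : Continuous fun τ : ℝ ↦ exp ((-τ) • T) (u (max τ 0)) :=
    ((differentiable_exp_smul_const ℝ T).continuous.comp continuous_neg).clm_apply
      (hu.comp_continuous (by fun_prop) fun τ ↦ le_max_right τ 0)
  refine ⟨fun t ↦ exp (t • T) (ξ₀ + ∫ τ in (0 : ℝ)..t, exp ((-τ) • T) (u (max τ 0))),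
    fun t ht ↦ ?_, by simp⟩
  have hint := (hcont.integral_hasStrictDerivAt 0 t).hasDerivAt.const_add ξ₀
  have hcancel : exp (t • T) (exp ((-t) • T) (u (max t 0))) = u t := by
    have hinv : exp (t • T) * exp ((-t) • T) = 1 := (exp_add_smul t (-t) T).symm.trans (by simp)
    rw [max_eq_left ht]
    exact DFunLike.congr_fun hinv (u t)
  simpa only [hcancel, mul_apply_eq_comp] using
    ((hasDerivAt_exp_smul_const' T t).clm_apply hint).hasDerivWithinAt (s := Set.Ici 0)

theorem IsForcedSolution.hasDerivWithinAt_exp_sub_smul_apply (hξ : IsForcedSolution T u ξ) (t : ℝ)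
    {τ : ℝ} (hτ : 0 ≤ τ) :
    HasDerivWithinAt (fun τ ↦ exp ((t - τ) • T) (ξ τ)) (exp ((t - τ) • T) (u τ)) (Set.Ici 0) τ := by
  have hexp : HasDerivAt (fun τ : ℝ ↦ exp ((t - τ) • T)) (-(exp ((t - τ) • T) * T)) τ := by
    simpa [Function.comp_def] using
      (hasDerivAt_exp_smul_const T (t - τ)).scomp τ ((hasDerivAt_id τ).const_sub t)
  simpa using hexp.hasDerivWithinAt.clm_apply (hξ τ hτ)

-- The propagated state `τ ↦ exp ((t - τ) • T) (ξ τ)` leads from `exp ((t - s) • T) (ξ s)` to `ξ t`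
-- with velocity `exp ((t - τ) • T) (u τ)`; the comparison function integrates the bound on it.
theorem IsForcedSolution.norm_le (hξ : IsForcedSolution T u ξ) {c lam : ℝ} (hlam : 0 < lam)
    (hT : ∀ t, 0 ≤ t → ‖exp (t • T)‖ ≤ c * Real.exp (-(lam * t)))
    {s t U : ℝ} (hs : 0 ≤ s) (hst : s ≤ t) (hu : ∀ τ ∈ Set.Icc s t, ‖u τ‖ ≤ U) :
    ‖ξ t‖ ≤ c * Real.exp (-(lam * (t - s))) * ‖ξ s‖ + c * U / lam := by
  have hc : 0 ≤ c := (norm_nonneg _).trans ((hT 0 le_rfl).trans_eq (by simp))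
  have hU : 0 ≤ U := (norm_nonneg _).trans (hu s ⟨le_rfl, hst⟩)
  have hderiv (τ : ℝ) (hτ : s ≤ τ) :
      HasDerivWithinAt (fun τ ↦ exp ((t - τ) • T) (ξ τ)) (exp ((t - τ) • T) (u τ)) (Set.Ici s) τ :=
    (hξ.hasDerivWithinAt_exp_sub_smul_apply t (hs.trans hτ)).mono (Set.Ici_subset_Ici.2 hs)
  have hbound (τ : ℝ) : HasDerivAt (fun τ ↦ c * Real.exp (-(lam * (t - s))) * ‖ξ s‖
      + c * U / lam * Real.exp (-(lam * (t - τ)))) (c * Real.exp (-(lam * (t - τ))) * U) τ := by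
    have hexponent : HasDerivAt (fun τ ↦ -(lam * (t - τ))) lam τ := by
      simpa using (((hasDerivAt_id' τ).const_sub t).const_mul lam).fun_neg
    refine ((hexponent.exp.const_mul (c * U / lam)).const_add _).congr_deriv ?_
    field_simp
  have hinit : ‖exp ((t - s) • T) (ξ s)‖ ≤ c * Real.exp (-(lam * (t - s))) * ‖ξ s‖
      + c * U / lam * Real.exp (-(lam * (t - s))) :=
    (ContinuousLinearMap.le_of_opNorm_le _ (hT _ (sub_nonneg.2 hst)) _).trans
      (le_add_of_nonneg_right (by positivity))
  have hgrowth (τ : ℝ) (hτ : τ ∈ Set.Ico s t) :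
      ‖exp ((t - τ) • T) (u τ)‖ ≤ c * Real.exp (-(lam * (t - τ))) * U :=
    ContinuousLinearMap.le_of_opNorm_le_of_le _ (hT _ (sub_nonneg.2 hτ.2.le))
      (hu τ ⟨hτ.1, hτ.2.le⟩)
  simpa using image_norm_le_of_norm_deriv_right_le_deriv_boundary
    (fun τ hτ ↦ ((hderiv τ hτ.1).continuousWithinAt.mono Set.Icc_subset_Ici_self))
    (fun τ hτ ↦ (hderiv τ hτ.1).mono (Set.Ici_subset_Ici.2 hτ.1)) hinit hbound hgrowth
    ⟨hst, le_rfl⟩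

theorem IsExponentiallyStable.exists_forall_norm_lt (hT : IsExponentiallyStable T) {ε : ℝ}
    (hε : 0 < ε) : ∃ δ > 0, ∀ u ξ : ℝ → E, IsForcedSolution T u ξ → ‖ξ 0‖ < δ →
      (∀ t, 0 ≤ t → ‖u t‖ ≤ δ) → ∀ t, 0 ≤ t → ‖ξ t‖ < ε := by
  obtain ⟨c, lam, hc, hlam, hdecay⟩ := hT
  refine ⟨ε / (c + c / lam), by positivity, fun u ξ hξ hξ0 hu t ht ↦ ?_⟩
  set δ := ε / (c + c / lam)
  calc ‖ξ t‖ ≤ c * Real.exp (-(lam * (t - 0))) * ‖ξ 0‖ + c * δ / lam :=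
        hξ.norm_le hlam hdecay le_rfl ht fun τ hτ ↦ hu τ hτ.1
    _ ≤ c * 1 * ‖ξ 0‖ + c * δ / lam := by
      gcongr
      exact Real.exp_le_one_iff.2 (by rw [sub_zero, neg_nonpos]; positivity)
    _ < c * 1 * δ + c * δ / lam := by gcongr
    _ = (c + c / lam) * δ := by ring
    _ = ε := mul_div_cancel₀ _ (by positivity)

theorem IsExponentiallyStable.tendsto_of_tendsto_input (hT : IsExponentiallyStable T)
    (hξ : IsForcedSolution T u ξ) (hu : Tendsto u atTop (𝓝 0)) : Tendsto ξ atTop (𝓝 0) := by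
  obtain ⟨c, lam, hc, hlam, hdecay⟩ := hT
  refine NormedAddGroup.tendsto_nhds_zero.2 fun ε hε ↦ ?_
  obtain ⟨s, hs⟩ := eventually_atTop.1
    (hu.norm.eventually_le_const (norm_zero.trans_lt (by positivity : 0 < lam * ε / (2 * c))))
  have htransient :
      Tendsto (fun t ↦ c * Real.exp (-(lam * (t - max s 0))) * ‖ξ (max s 0)‖) atTop (𝓝 0) := by
    have hexponent : Tendsto (fun t ↦ lam * (t - max s 0)) atTop atTop :=
      (tendsto_atTop_add_const_right _ _ tendsto_id).const_mul_atTop hlam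
    simpa using
      ((Real.tendsto_exp_neg_atTop_nhds_zero.comp hexponent).const_mul c).mul_const ‖ξ (max s 0)‖
  filter_upwards [htransient.eventually_lt_const (half_pos hε), eventually_ge_atTop (max s 0)]
    with t hsmall ht
  calc ‖ξ t‖ ≤ c * Real.exp (-(lam * (t - max s 0))) * ‖ξ (max s 0)‖
        + c * (lam * ε / (2 * c)) / lam :=
        hξ.norm_le hlam hdecay (le_max_right s 0) ht
          fun τ hτ ↦ hs τ ((le_max_left s 0).trans hτ.1)
    _ < ε / 2 + c * (lam * ε / (2 * c)) / lam := by gcongr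
    _ = ε := by field_simp; ring

end LinearSystem

section Cascade

variable {E F : Type*} [NormedAddCommGroup E] [NormedSpace ℝ E] [CompleteSpace E]
  [NormedAddCommGroup F] [NormedSpace ℝ F]

theorem IsGAS.cascade {f : F → F} (hf : IsGAS f) {T : E →L[ℝ] E} (hT : IsExponentiallyStable T)
    {h : F → E} (hh : Continuous h) (h0 : h 0 = 0) :
    IsGAS fun z : E × F ↦ (T z.1 + h z.2, f z.2) := by
  have hfst {z : ℝ → E × F} (hz : IsForwardSolution (fun z ↦ (T z.1 + h z.2, f z.2)) z) :
      IsForcedSolution T (fun t ↦ h (z t).2) fun t ↦ (z t).1 := fun t ht ↦ (hz t ht).fst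
  have hsnd {z : ℝ → E × F} (hz : IsForwardSolution (fun z ↦ (T z.1 + h z.2, f z.2)) z) :
      IsForwardSolution f fun t ↦ (z t).2 := fun t ht ↦ (hz t ht).snd
  refine ⟨by simp [hf.equilibrium, h0], fun z₀ ↦ ?_, fun ε hε ↦ ?_, fun z hz ↦ ?_⟩
  · obtain ⟨χ, hχ, hχ0⟩ := hf.forward_complete z₀.2
    have hinput : ContinuousOn (fun t ↦ h (χ t)) (Set.Ici 0) :=
      hh.comp_continuousOn fun t ht ↦ (hχ t ht).continuousWithinAt
    obtain ⟨ξ, hξ, hξ0⟩ := exists_isForcedSolution T hinput z₀.1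
    exact ⟨fun t ↦ (ξ t, χ t), fun t ht ↦ (hξ t ht).prodMk (hχ t ht), Prod.ext hξ0 hχ0⟩
  · obtain ⟨δ₁, hδ₁, hξ⟩ := hT.exists_forall_norm_lt hε
    obtain ⟨η, hη, hinput⟩ := Metric.continuous_iff.1 hh 0 δ₁ hδ₁
    simp only [h0, dist_zero_right] at hinput
    obtain ⟨δ₂, hδ₂, hχ⟩ := hf.stable (min ε η) (lt_min hε hη)
    refine ⟨min δ₁ δ₂, lt_min hδ₁ hδ₂, fun z hz hz0 t ht ↦ ?_⟩
    obtain ⟨hz0₁, hz0₂⟩ := lt_min_iff.1 hz0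
    have hχz := hχ _ (hsnd hz) ((norm_snd_le _).trans_lt hz0₂)
    refine max_lt ?_ ((hχz t ht).trans_le (min_le_left _ _))
    exact hξ _ _ (hfst hz) ((norm_fst_le _).trans_lt hz0₁)
      (fun τ hτ ↦ (hinput _ ((hχz τ hτ).trans_le (min_le_right _ _))).le) t ht
  · have hχ := hf.attractive _ (hsnd hz)
    have hinput : Tendsto (fun t ↦ h (z t).2) atTop (𝓝 0) := (hh.tendsto' 0 0 h0).comp hχ
    exact (hT.tendsto_of_tendsto_input (hfst hz) hinput).prodMk_nhds hχ

end Cascade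

end ADRC

theorem corollary1_general {n F : Type*} [Fintype n] [DecidableEq n] [NormedAddCommGroup F]
    [NormedSpace ℝ F] {A : Matrix n n ℝ} (hA : ADRC.IsHurwitz A) {f : F → F} (hf : ADRC.IsGAS f)
    {h : F → EuclideanSpace ℝ n} (hh : Continuous h) (h0 : h 0 = 0) :
    ADRC.IsGAS fun z : EuclideanSpace ℝ n × F ↦ (Matrix.toEuclideanLin A z.1 + h z.2, f z.2) :=
  hf.cascade hA.isExponentiallyStable hh h0

theorem corollary1 (a : Fin 3 → ℝ) (b bhat : ℝ) (hb : b ≠ 0) (hbhat : bhat ≠ 0)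
    (K : Fin 3 → ℝ) (G : Fin 4 → ℝ)
    (hA : ADRC.IsHurwitz (ADRC.closedLoopMatrix a b bhat K G))
    (M : ℕ) (fd : EuclideanSpace ℝ (Fin M) → EuclideanSpace ℝ (Fin M))
    (hfd : LocallyLipschitz fd) (Cd : Matrix (Fin 1) (Fin M) ℝ)
    (hgas : ADRC.IsGAS fd) :
    ADRC.IsGAS (ADRC.cascadeField a b bhat K G fd Cd) :=
  corollary1_general hA hgas
    (h := Matrix.toEuclideanLin (ADRC.closedLoopInput * Cd))
    (LinearMap.continuous_of_finiteDimensional _) (map_zero _)
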